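/- **Theorem.** A $[0,1]$-weighted graph $G$ on the vertex set $\{1,\dots,n\}$ is given by symmetric edge weights $w_{u,v}(G)\in[0,1]$, $u\neq v$ (weight $0$ means no edge). Two such graphs on the same vertex set are *neighbors* if they differ in the weight of at most one edge $\{a,b\}$. The *edge matrix* of edge weights $c_{u,v}\ge 0$ is the $\binom n2\times n$ matrix $E$ with one row for each pair $u<v$, which has entry $\sqrt{c_{u,v}}$ in column $u$, entry $-\sqrt{c_{u,v}}$ in column $v$, and $0$ in all other columns. Let $\epsilon,\delta,\eta,\nu>0$ with $\nu<2$, and put $$r=\left\lceil \frac{8\ln(2/\nu)}{\eta^2}\right\rceil,\qquad w=\frac{\sqrt{32\,r\ln(2/\delta)}}{\epsilon}\,\ln\frac{4r}{\delta}.$$ Assume that $\epsilon\le 2\ln(2/\delta)$ and $w\le n$. Consider the randomized algorithm that, on input a $[0,1]$-weighted graph $G$ on $n$ vertices, 1. replaces every edge weight $w_{u,v}$, $u\ne v$, by $\frac wn+\left(1-\frac wn\right)w_{u,v}$, and lets $E_G$ be the edge matrix of the resulting weights; 2. draws an $r\times\binom n2$ matrix $M$ with i.i.d. $\mathcal N(0,1)$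 entries; 3. outputs the $n\times n$ matrix $\tilde L(G)=\frac1r E_G^{\mathsf T}M^{\mathsf T}ME_G$. This algorithm is $(\epsilon,\delta)$-differentially private with respect to a change of the weight of a single edge: for all neighboring $G,G'$ and every measurable set $S$ of real $n\times n$ matrices, $$\Pr[\tilde L(G)\in S]\le e^{\epsilon}\,\Pr[\tilde L(G')\in S]+\delta .$$ -/

import Mathlib

open MeasureTheory ProbabilityTheory

/-- A `[0,1]`-weighted undirected graph on the vertex set `Fin n`; the weight `0` means that there
is no edge. -/
@[ext] structure WeightedGraph (n : ℕ) where
  weight : Fin n → Fin n → ℝ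
  symm : ∀ u v, weight u v = weight v u
  loopless : ∀ u, weight u u = 0
  nonneg : ∀ u v, 0 ≤ weight u v
  le_one : ∀ u v, weight u v ≤ 1

/-- Two weighted graphs are neighbors if they differ at most in the weight of a single edge
`{a, b}`. -/
def WeightedGraph.Neighbor {n : ℕ} (G G' : WeightedGraph n) : Prop :=
  ∃ a b : Fin n, a ≠ b ∧
    ∀ u v : Fin n, s(u, v) ≠ s(a, b) → G.weight u v = G'.weight u v

/-- The unordered pairs of distinct vertices, written as the pairs `(u, v)` with `u < v`. -/
abbrev VertexPair (n : ℕ) : Type := {p : Fin n × Fin n // p.1 < p.2}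

/-- The `(n choose 2) × n` edge matrix of a graph with edge weights `c`. The row of `{u, v}`,
`u < v`, has `√(c u v)` in column `u`, `-√(c u v)` in column `v`, and `0` elsewhere. -/
noncomputable def edgeMatrix {n : ℕ} (c : Fin n → Fin n → ℝ) :
    Matrix (VertexPair n) (Fin n) ℝ :=
  fun p x =>
    if x = p.1.1 then √(c p.1.1 p.1.2)
    else if x = p.1.2 then -√(c p.1.1 p.1.2)
    else 0

/-- The number of rows of the random projection: `8 ln (2 / ν) / η ^ 2`, rounded up. -/
noncomputable def numRows (η ν : ℝ) : ℕ :=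
  ⌈8 * Real.log (2 / ν) / η ^ 2⌉₊

/-- The parameter `w = √(32 r ln (2 / δ)) / ε * ln (4 r / δ)`. -/
noncomputable def mixWeight (ε δ : ℝ) (r : ℕ) : ℝ :=
  √(32 * r * Real.log (2 / δ)) / ε * Real.log (4 * r / δ)

/-- The edge weights of the mixture of `G` with the `w / n`-weighted complete graph. -/
noncomputable def WeightedGraph.mixedWeight {n : ℕ} (G : WeightedGraph n) (w : ℝ) :
    Fin n → Fin n → ℝ :=
  fun u v => if u = v then 0 else w / n + (1 - w / n) * G.weight u v

/-- The product (Borel) σ-algebra on real matrices. -/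
instance instMeasurableSpaceRealMatrix (ι κ : Type) : MeasurableSpace (Matrix ι κ ℝ) :=
  inferInstanceAs (MeasurableSpace (ι → κ → ℝ))

/-- The law of a random matrix with i.i.d. standard normal entries. -/
noncomputable def gaussianMatrix (ι κ : Type) [Fintype ι] [Fintype κ] :
    Measure (Matrix ι κ ℝ) :=
  Measure.pi fun _ : ι => Measure.pi fun _ : κ => gaussianReal 0 1

instance (ι κ : Type) [Fintype ι] [Fintype κ] : IsProbabilityMeasure (gaussianMatrix ι κ) := by
  exact inferInstanceAs (IsProbabilityMeasure
    (Measure.pi fun _ : ι => Measure.pi fun _ : κ => gaussianReal 0 1))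

/-- The matrix `(1 / r) Eᵀ Mᵀ M E`. -/
noncomputable def projectedLaplacian {n r : ℕ} (E : Matrix (VertexPair n) (Fin n) ℝ)
    (M : Matrix (Fin r) (VertexPair n) ℝ) : Matrix (Fin n) (Fin n) ℝ :=
  (1 / (r : ℝ)) • (E.transpose * M.transpose * M * E)

/-- The mechanism: on input `G` it sets `r` and `w`, mixes the `w / n`-weighted complete graph into
`G`, draws an `r × (n choose 2)` standard Gaussian matrix `M` and returns `(1 / r) Eᵀ Mᵀ M E`, where
`E` is the edge matrix of the modified graph. Its value is the law of the output. -/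
noncomputable def publishLaplacian {n : ℕ} (ε δ η ν : ℝ) (G : WeightedGraph n) :
    Measure (Matrix (Fin n) (Fin n) ℝ) :=
  (gaussianMatrix (Fin (numRows η ν)) (VertexPair n)).map
    (projectedLaplacian (edgeMatrix (G.mixedWeight (mixWeight ε δ (numRows η ν)))))

theorem measurable_projectedLaplacian {n r : ℕ} (E : Matrix (VertexPair n) (Fin n) ℝ) :
    Measurable (projectedLaplacian (r := r) E) := by
  have h : Continuous (projectedLaplacian (r := r) E) := by
    unfold projectedLaplacian
    fun_prop
  refine measurable_pi_lambda _ fun i => measurable_pi_lambda _ fun j => ?_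
  have : Continuous fun M : Fin r → VertexPair n → ℝ => projectedLaplacian E M i j :=
    (continuous_apply j).comp ((continuous_apply i).comp h)
  exact this.measurable

/-- The output of the mechanism is a genuine random matrix. -/
instance {n : ℕ} (ε δ η ν : ℝ) (G : WeightedGraph n) :
    IsProbabilityMeasure (publishLaplacian ε δ η ν G) :=
  Measure.isProbabilityMeasure_map (measurable_projectedLaplacian _).aemeasurable

/-- `(ε, δ)`-differential privacy of a randomized algorithm, given by the law of its output on each
input, with respect to a neighboring relation on the inputs. -/
def IsDifferentiallyPrivate {I R : Type} [MeasurableSpace R] (neighbor : I → I → Prop)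
    (alg : I → Measure R) (ε δ : ℝ) : Prop :=
  ∀ x x' : I, neighbor x x' → ∀ S : Set R, MeasurableSet S →
    (alg x).real S ≤ Real.exp ε * (alg x').real S + δ

/-! The output depends only on the rows of `M * E`, which are i.i.d. centered Gaussian vectors whose
covariance is the Laplacian `Eᵀ E` of the mixed graph. Let the neighbors differ in the edge `{a, b}`
and put `u = e_a - e_b`. The complete graph with weights `w / n` has a Laplacian dominating `(w / 2)
u uᵀ`, since its nonzero eigenvalues are `w` and `|u|² = 2`. Hence both Laplacians split as `v u uᵀ
+ Pᵀ P` with the same `P`, with `v ≥ w / 2`, and with the two values of `v` at most `1` apart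
(`exists_common_splitting`). Each row is then a scalar `N(0, v)` times `u` plus independent noise of
the same law for both graphs (`map_vecMul_eq_map_smul_add_vecMul`).

Noise and postprocessing cost no privacy (`map_prod_le_mul_add`), so it remains to compare `r`
independent `N(0, v)` with `r` independent `N(0, v')`, where the relative change of variance is at
most `2 / w`. The exponential moment of the log-likelihood ratio is explicit and of second order in
`2 / w`; Markov's inequality at exponent `2 ln (2 / δ) / ε` gives the claim
(`isotropicGaussian_le_of_mixWeight`). -/

open scoped NNReal ENNReal

/-! ### Likelihood ratios of centered Gaussians -/

/-- The logarithm of the density of `N(0, v')` with respect to `N(0, v)`. -/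
noncomputable def gaussianLogRatio (v v' x : ℝ) : ℝ :=
  (Real.log v - Real.log v') / 2 + (1 / v - 1 / v') / 2 * x ^ 2

theorem measurable_gaussianLogRatio (v v' : ℝ) : Measurable (gaussianLogRatio v v') := by
  unfold gaussianLogRatio
  fun_prop

theorem measurable_sum_gaussianLogRatio (r : ℕ) (v v' : ℝ) :
    Measurable fun x : Fin r → ℝ => ∑ i, gaussianLogRatio v v' (x i) :=
  Finset.measurable_sum _ fun i _ =>
    (measurable_gaussianLogRatio _ _).comp (measurable_pi_apply i)

theorem gaussianPDFReal_zero_mean_eq_mul_exp {v v' : ℝ≥0} (hv : 0 < v) (hv' : 0 < v') (x : ℝ) :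
    gaussianPDFReal 0 v' x = gaussianPDFReal 0 v x * Real.exp (gaussianLogRatio v v' x) := by
  have h : (0 : ℝ) < v := hv
  have h' : (0 : ℝ) < v' := hv'
  have key (u : ℝ≥0) (hu : (0 : ℝ) < u) : gaussianPDFReal 0 u x =
      Real.exp (-(Real.log (2 * Real.pi) + Real.log u) / 2 - 1 / u / 2 * x ^ 2) := by
    have hpi : (0 : ℝ) < 2 * Real.pi := by positivity
    have hsqrt : Real.exp (-(Real.log (2 * Real.pi) + Real.log u) / 2) = (√(2 * Real.pi * u))⁻¹ := by
      rw [← Real.log_mul hpi.ne' hu.ne', neg_div, Real.exp_neg, Real.exp_half,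
        Real.exp_log (by positivity)]
    rw [gaussianPDFReal, sub_eq_add_neg (-_ / 2), Real.exp_add, hsqrt]
    congr 2
    field_simp
    ring
  rw [key v h, key v' h', ← Real.exp_add, gaussianLogRatio]
  congr 1
  ring

theorem gaussianReal_eq_withDensity_logRatio {v v' : ℝ≥0} (hv : 0 < v) (hv' : 0 < v') :
    gaussianReal 0 v' = (gaussianReal 0 v).withDensity
      (fun x => ENNReal.ofReal (Real.exp (gaussianLogRatio v v' x))) := by
  rw [gaussianReal_of_var_ne_zero _ hv.ne', gaussianReal_of_var_ne_zero _ hv'.ne',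
    ← withDensity_mul _ (measurable_gaussianPDF _ _)
      (measurable_gaussianLogRatio _ _).exp.ennreal_ofReal]
  congr 1
  ext1 x
  rw [Pi.mul_apply, gaussianPDF, gaussianPDF, gaussianPDFReal_zero_mean_eq_mul_exp hv hv',
    ENNReal.ofReal_mul (gaussianPDFReal_nonneg _ _ _)]

/-- On a box the indicator factors over the coordinates, and under a product measure the coordinates
are independent, so the integral of the product factors. -/
theorem pi_withDensity_eq_withDensity_prod {ι : Type*} [Fintype ι] {X : ι → Type*}
    [∀ i, MeasurableSpace (X i)] (μ : ∀ i, Measure (X i)) [∀ i, IsProbabilityMeasure (μ i)]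
    (f : ∀ i, X i → ℝ≥0∞) (hf : ∀ i, Measurable (f i))
    [∀ i, SigmaFinite ((μ i).withDensity (f i))] :
    Measure.pi (fun i => (μ i).withDensity (f i)) =
      (Measure.pi μ).withDensity (fun x => ∏ i, f i (x i)) := by
  classical
  refine Measure.pi_eq fun s hs => ?_
  rw [withDensity_apply _ (MeasurableSet.univ_pi hs), ← lintegral_indicator (MeasurableSet.univ_pi hs)]
  have hind : (Set.univ.pi s).indicator (fun x => ∏ i, f i (x i)) =
      fun x => ∏ i, (s i).indicator (f i) (x i) := by
    ext1 x
    by_cases hx : x ∈ Set.univ.pi s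
    · rw [Set.indicator_of_mem hx]
      exact Finset.prod_congr rfl fun i _ => (Set.indicator_of_mem (hx i trivial) _).symm
    · rw [Set.indicator_of_notMem hx]
      simp only [Set.mem_pi, Set.mem_univ, true_imp_iff, not_forall] at hx
      obtain ⟨i, hi⟩ := hx
      exact (Finset.prod_eq_zero (Finset.mem_univ i) (Set.indicator_of_notMem hi _)).symm
  have hm (i : ι) : Measurable ((s i).indicator (f i)) := (hf i).indicator (hs i)
  rw [hind, lintegral_prod_eq_prod_lintegral_of_indepFun Finset.univ
    (fun i (x : ∀ i, X i) => (s i).indicator (f i) (x i))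
    (iIndepFun_pi (X := fun i => (s i).indicator (f i)) fun i => (hm i).aemeasurable)
    (fun i => (hm i).comp (measurable_pi_apply i))]
  refine Finset.prod_congr rfl fun i _ => ?_
  rw [withDensity_apply _ (hs i), ← lintegral_indicator (hs i)]
  exact (measurePreserving_eval μ i).lintegral_comp (hm i)

/-- The law of `r` independent centered Gaussians of variance `v`. -/
noncomputable def isotropicGaussian (r : ℕ) (v : ℝ≥0) : Measure (Fin r → ℝ) :=
  Measure.pi fun _ => gaussianReal 0 v

instance (r : ℕ) (v : ℝ≥0) : IsProbabilityMeasure (isotropicGaussian r v) :=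
  inferInstanceAs (IsProbabilityMeasure (Measure.pi fun _ : Fin r => gaussianReal 0 v))

theorem isotropicGaussian_eq_withDensity (r : ℕ) {v v' : ℝ≥0} (hv : 0 < v) (hv' : 0 < v') :
    isotropicGaussian r v' = (isotropicGaussian r v).withDensity
      (fun x => ENNReal.ofReal (Real.exp (∑ i, gaussianLogRatio v v' (x i)))) := by
  unfold isotropicGaussian
  have hsf : SigmaFinite ((gaussianReal 0 v).withDensity
      (fun x => ENNReal.ofReal (Real.exp (gaussianLogRatio v v' x)))) := by
    rw [← gaussianReal_eq_withDensity_logRatio hv hv']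
    infer_instance
  rw [gaussianReal_eq_withDensity_logRatio hv hv', pi_withDensity_eq_withDensity_prod _ _
    fun _ => (measurable_gaussianLogRatio _ _).exp.ennreal_ofReal]
  congr 1
  ext1 x
  rw [Real.exp_sum, ENNReal.ofReal_prod_of_nonneg fun _ _ => (Real.exp_pos _).le]

/-- The exponential moment of the log-likelihood ratio. -/
theorem lintegral_exp_mul_sum_logRatio (r : ℕ) {v v' : ℝ≥0} (hv : 0 < v) (hv' : 0 < v') {k : ℝ}
    (hk : k * ((v' : ℝ) / v - 1) < 1) :
    ∫⁻ x, ENNReal.ofReal (Real.exp (k * ∑ i, gaussianLogRatio v v' (x i)))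
        ∂(isotropicGaussian r v') =
      ENNReal.ofReal (Real.exp (r * (-(k * Real.log ((v' : ℝ) / v)) / 2
        - Real.log (1 - k * ((v' : ℝ) / v - 1)) / 2))) := by
  have h : (0 : ℝ) < v := hv
  have h' : (0 : ℝ) < v' := hv'
  have h1 : 0 < 1 - k * ((v' : ℝ) / v - 1) := by linarith
  -- Exponential tilting: multiplying the `N(0, v')` density by `exp (k * logRatio)` gives, up to
  -- the constant `exp C`, the density of `N(0, u)`. The condition `hk` keeps `u` positive. The
  -- remaining integral is then the total mass of a Gaussian.
  set u : ℝ≥0 := ⟨(v' : ℝ) / (1 - k * ((v' : ℝ) / v - 1)), by positivity⟩ with hu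
  have hur : (u : ℝ) = (v' : ℝ) / (1 - k * ((v' : ℝ) / v - 1)) := rfl
  have hu0 : 0 < u := by
    have : (0 : ℝ) < u := by rw [hur]; positivity
    exact this
  set C : ℝ := -(k * Real.log ((v' : ℝ) / v)) / 2 - Real.log (1 - k * ((v' : ℝ) / v - 1)) / 2
    with hC
  have hpt (x : ℝ) : k * gaussianLogRatio v v' x = C + gaussianLogRatio v' u x := by
    rw [hC, gaussianLogRatio, gaussianLogRatio, hur, Real.log_div h'.ne' h1.ne',
      Real.log_div h'.ne' h.ne', one_div_div]
    field_simp
    ring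
  have hsum (x : Fin r → ℝ) : ENNReal.ofReal (Real.exp (k * ∑ i, gaussianLogRatio v v' (x i))) =
      ENNReal.ofReal (Real.exp (r * C)) *
        ENNReal.ofReal (Real.exp (∑ i, gaussianLogRatio v' u (x i))) := by
    rw [Finset.mul_sum, Finset.sum_congr rfl fun i _ => hpt (x i), Finset.sum_add_distrib,
      Real.exp_add, ENNReal.ofReal_mul (Real.exp_pos _).le]
    simp
  have hmeas : Measurable fun x : Fin r → ℝ =>
      ENNReal.ofReal (Real.exp (∑ i, gaussianLogRatio v' u (x i))) :=
    (measurable_sum_gaussianLogRatio _ _ _).exp.ennreal_ofReal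
  simp_rw [hsum]
  rw [lintegral_const_mul _ hmeas, ← setLIntegral_univ, ← withDensity_apply _ MeasurableSet.univ,
    ← isotropicGaussian_eq_withDensity r hv' hu0, measure_univ, mul_one]

/-- A bound on the exponential moment of the privacy loss gives approximate indistinguishability. -/
theorem measure_le_exp_mul_add_of_exp_moment {X : Type*} [MeasurableSpace X] {P Q : Measure X}
    {l : X → ℝ} (hl : Measurable l)
    (hPQ : P = Q.withDensity (fun x => ENNReal.ofReal (Real.exp (l x)))) {k ε δ : ℝ} (hk : 0 < k)
    (hmom : ∫⁻ x, ENNReal.ofReal (Real.exp (k * l x)) ∂P ≤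
      ENNReal.ofReal (Real.exp (k * ε) * δ)) {A : Set X} (hA : MeasurableSet A) :
    P A ≤ ENNReal.ofReal (Real.exp ε) * Q A + ENNReal.ofReal δ := by
  have hB : MeasurableSet {x | l x ≤ ε} := measurableSet_le hl measurable_const
  have h1 : P (A ∩ {x | l x ≤ ε}) ≤ ENNReal.ofReal (Real.exp ε) * Q A := by
    rw [hPQ, withDensity_apply _ (hA.inter hB)]
    calc _ ≤ ∫⁻ _ in A ∩ {x | l x ≤ ε}, ENNReal.ofReal (Real.exp ε) ∂Q :=
          setLIntegral_mono measurable_const fun x hx =>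
            ENNReal.ofReal_le_ofReal (Real.exp_le_exp.2 hx.2)
      _ = ENNReal.ofReal (Real.exp ε) * Q (A ∩ {x | l x ≤ ε}) := setLIntegral_const _ _
      _ ≤ _ := by gcongr; exact Set.inter_subset_left
  -- Markov's inequality for `exp (k * l)` bounds the event of large privacy loss.
  have h2 : P {x | l x ≤ ε}ᶜ ≤ ENNReal.ofReal δ := by
    have hsub : {x | l x ≤ ε}ᶜ ⊆ {x | ENNReal.ofReal (Real.exp (k * ε)) ≤
        ENNReal.ofReal (Real.exp (k * l x))} := fun x hx => by
      have : ε < l x := not_le.1 hx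
      exact ENNReal.ofReal_le_ofReal (Real.exp_le_exp.2 (by gcongr))
    have hpos : 0 < Real.exp (k * ε) := Real.exp_pos _
    have h3 := mul_meas_ge_le_lintegral (μ := P)
      (f := fun x => ENNReal.ofReal (Real.exp (k * l x)))
      (hl.const_mul k).exp.ennreal_ofReal (ENNReal.ofReal (Real.exp (k * ε)))
    rw [ENNReal.ofReal_mul hpos.le] at hmom
    refine (measure_mono hsub).trans ?_
    exact (ENNReal.mul_le_mul_iff_right (ENNReal.ofReal_pos.2 hpos).ne' ENNReal.ofReal_ne_top).1
      (h3.trans hmom)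
  calc P A = P (A ∩ {x | l x ≤ ε}) + P (A \ {x | l x ≤ ε}) := (measure_inter_add_sdiff A hB).symm
    _ ≤ _ := add_le_add h1 ((measure_mono fun x hx => hx.2).trans h2)

/-- Apply `log y ≥ 1 - 1 / y` at `y = 1 - x`; the error `x ^ 2 / (1 - x)` is at most `2 * x ^ 2`.
Negative `x` is allowed, as the variance may decrease. -/
theorem neg_log_one_sub_le {x : ℝ} (hx : x ≤ 1 / 2) : -Real.log (1 - x) ≤ x + 2 * x ^ 2 := by
  have h : 0 < 1 - x := by linarith
  have h1 := Real.one_sub_inv_le_log_of_pos h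
  have h2 : (1 - x)⁻¹ - 1 = x + x ^ 2 * (1 - x)⁻¹ := by
    field_simp
    ring
  have h3 : (1 - x)⁻¹ ≤ 2 := inv_le_of_inv_le₀ (by norm_num) (by linarith)
  nlinarith [mul_le_mul_of_nonneg_left h3 (sq_nonneg x)]

/-- Isotropic Gaussians of nearby variances are approximately indistinguishable. -/
theorem isotropicGaussian_le_exp_mul_add {r : ℕ} {v v' : ℝ≥0} (hv : 0 < v) (hv' : 0 < v')
    {k τ ε δ : ℝ} (hk : 0 < k) (hδ : 0 < δ) (hτ : 0 ≤ τ) (hkτ : k * τ ≤ 1 / 2)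
    (h1 : |(v' : ℝ) - v| ≤ τ * v) (h2 : |(v' : ℝ) - v| ≤ τ * v')
    (hbound : r * (k + 2 * k ^ 2) * τ ^ 2 / 2 ≤ k * ε + Real.log δ) {A : Set (Fin r → ℝ)}
    (hA : MeasurableSet A) :
    isotropicGaussian r v' A ≤
      ENNReal.ofReal (Real.exp ε) * isotropicGaussian r v A + ENNReal.ofReal δ := by
  have h : (0 : ℝ) < v := hv
  have h' : (0 : ℝ) < v' := hv'
  set θ : ℝ := (v' : ℝ) / v with hθ
  have hθ0 : 0 < θ := by positivity
  have hθ1 : θ - 1 = ((v' : ℝ) - v) / v := by rw [hθ]; field_simp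
  have ha : |θ - 1| ≤ τ := by
    rwa [hθ1, abs_div, abs_of_pos h, div_le_iff₀ h]
  -- The quotient is the product of the changes relative to `v` and to `v'`, hence the need for both
  -- `h1` and `h2`.
  have hb : (θ - 1) ^ 2 / θ ≤ τ ^ 2 := by
    have : (θ - 1) ^ 2 / θ = (|(v' : ℝ) - v| / v) * (|(v' : ℝ) - v| / v') := by
      rw [div_mul_div_comm, ← sq, sq_abs, hθ1, hθ]
      field_simp
    rw [this, sq]
    exact mul_le_mul ((div_le_iff₀ h).2 h1) ((div_le_iff₀ h').2 h2) (by positivity) hτ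
  have hk1 : k * (θ - 1) ≤ 1 / 2 :=
    (mul_le_mul_of_nonneg_left ((le_abs_self _).trans ha) hk.le).trans hkτ
  -- The first-order terms `k * (θ - 1)` and `-k * (1 - θ⁻¹)` nearly cancel, leaving `k * (θ - 1) ^
  -- 2 / θ`.
  have hlog : -(k * Real.log θ) - Real.log (1 - k * (θ - 1)) ≤ (k + 2 * k ^ 2) * τ ^ 2 := by
    have e1 := neg_log_one_sub_le hk1
    have e2 := mul_le_mul_of_nonneg_left (Real.one_sub_inv_le_log_of_pos hθ0) hk.le
    have e3 : (θ - 1) ^ 2 / θ = θ - 1 - (1 - θ⁻¹) := by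
      field_simp
    have e4 := mul_le_mul_of_nonneg_left hb hk.le
    rw [e3] at e4
    have e5 : (θ - 1) ^ 2 ≤ τ ^ 2 := sq_le_sq' (abs_le.1 ha).1 (abs_le.1 ha).2
    have e6 := mul_le_mul_of_nonneg_left e5 (sq_nonneg k)
    linarith
  refine measure_le_exp_mul_add_of_exp_moment
    (measurable_sum_gaussianLogRatio _ _ _)
    (isotropicGaussian_eq_withDensity r hv hv') hk ?_ hA
  rw [lintegral_exp_mul_sum_logRatio r hv hv' (by linarith)]
  refine ENNReal.ofReal_le_ofReal ?_
  conv_rhs => rw [← Real.exp_log hδ, ← Real.exp_add]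
  refine Real.exp_le_exp.2 (le_trans ?_ hbound)
  have := mul_le_mul_of_nonneg_left hlog (Nat.cast_nonneg (α := ℝ) r)
  linarith

/-! ### Consequences of the choice of `r` and `w` -/

theorem one_le_numRows {η ν : ℝ} (hη : 0 < η) (hν : 0 < ν) (hν2 : ν < 2) : 1 ≤ numRows η ν := by
  refine Nat.one_le_ceil_iff.2 ?_
  have : 0 < Real.log (2 / ν) := Real.log_pos ((one_lt_div hν).2 hν2)
  positivity

theorem log_two_div_add_le_log_four_mul_div {δ : ℝ} (hδ : 0 < δ) {r : ℕ} (hr : 1 ≤ r) :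
    Real.log (2 / δ) + Real.log 2 ≤ Real.log (4 * r / δ) := by
  rw [← Real.log_mul (by positivity) (by norm_num)]
  refine Real.log_le_log (by positivity) ?_
  have : (1 : ℝ) ≤ r := by exact_mod_cast hr
  rw [div_mul_eq_mul_div]
  exact div_le_div_of_nonneg_right (by linarith) hδ.le

theorem log_two_le_log_two_div {δ : ℝ} (hδ : 0 < δ) (hδ1 : δ < 1) :
    Real.log 2 ≤ Real.log (2 / δ) :=
  Real.log_le_log (by norm_num) (by rw [le_div_iff₀ hδ]; linarith)

theorem mixWeight_pos {ε δ : ℝ} (hε : 0 < ε) (hδ : 0 < δ) (hδ1 : δ < 1) {r : ℕ} (hr : 1 ≤ r) :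
    0 < mixWeight ε δ r := by
  have h0 := Real.log_two_gt_d9
  have h1 := log_two_div_add_le_log_four_mul_div hδ hr
  have h2 := log_two_le_log_two_div hδ hδ1
  have hX : 0 < Real.log (2 / δ) := by linarith
  have hl : 0 < Real.log (4 * r / δ) := by linarith
  have hr' : (0 : ℝ) < r := by exact_mod_cast hr
  unfold mixWeight
  positivity

theorem sq_two_div_mixWeight {ε δ : ℝ} (hX : 0 ≤ Real.log (2 / δ)) (r : ℕ) :
    (2 / mixWeight ε δ r) ^ 2 =
      ε ^ 2 / (8 * r * Real.log (2 / δ) * Real.log (4 * r / δ) ^ 2) := by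
  rw [mixWeight, div_pow, mul_pow, div_pow, Real.sq_sqrt (by positivity), div_mul_eq_mul_div,
    div_div_eq_mul_div, show (32 : ℝ) * r * Real.log (2 / δ) * Real.log (4 * r / δ) ^ 2 =
      4 * (8 * r * Real.log (2 / δ) * Real.log (4 * r / δ) ^ 2) by ring,
    show (2 : ℝ) ^ 2 * ε ^ 2 = 4 * ε ^ 2 by ring, mul_div_mul_left _ _ (by norm_num)]

/-- The mixing weight is large enough to hide a variance change of at most `1`. -/
theorem isotropicGaussian_le_of_mixWeight {ε δ : ℝ} (hε : 0 < ε) (hδ : 0 < δ) (hδ1 : δ < 1)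
    (hεδ : ε ≤ 2 * Real.log (2 / δ)) {r : ℕ} (hr : 1 ≤ r) {v v' : ℝ≥0}
    (hv : mixWeight ε δ r / 2 ≤ v) (hv' : mixWeight ε δ r / 2 ≤ v')
    (hvv : |(v' : ℝ) - v| ≤ 1) {A : Set (Fin r → ℝ)} (hA : MeasurableSet A) :
    isotropicGaussian r v' A ≤
      ENNReal.ofReal (Real.exp ε) * isotropicGaussian r v A + ENNReal.ofReal δ := by
  have hw := mixWeight_pos hε hδ hδ1 hr
  have hsq := sq_two_div_mixWeight (ε := ε)
    ((Real.log_nonneg one_le_two).trans (log_two_le_log_two_div hδ hδ1)) r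
  set w := mixWeight ε δ r
  have hl2 := log_two_div_add_le_log_four_mul_div hδ hr
  have hX2 := log_two_le_log_two_div hδ hδ1
  have hr' : (1 : ℝ) ≤ r := by exact_mod_cast hr
  have h2 := Real.log_two_gt_d9
  have hlogδ : Real.log δ = Real.log 2 - Real.log (2 / δ) := by
    rw [Real.log_div (by norm_num) hδ.ne']
    ring
  set X := Real.log (2 / δ)
  set l := Real.log (4 * r / δ)
  set τ := 2 / w
  have hτ : 0 < τ := by positivity
  have hXpos : 0 < X := by linarith
  have hl1 : 1 ≤ l := by linarith
  -- Since `l ≥ X + ln 2`, AM-GM gives `l ^ 2 ≥ 4 * X * ln 2`, and `ln 2 > 1 / 2`.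
  have hlX : 2 * X ≤ l ^ 2 := by nlinarith [sq_nonneg (X - Real.log 2)]
  have hone {u : ℝ≥0} (hu : w / 2 ≤ u) : 1 ≤ τ * u := by
    calc (1 : ℝ) = τ * (w / 2) := by simp only [τ]; field_simp
      _ ≤ τ * u := by gcongr
  have hrτ : r * τ ^ 2 * (8 * X * l ^ 2) = ε ^ 2 := by
    rw [hsq]
    field_simp
  have hrτ1 : r * τ ^ 2 * (8 * X) ≤ ε ^ 2 := by
    rw [← hrτ]
    have : 1 ≤ l ^ 2 := by nlinarith
    have h0 : 0 ≤ r * τ ^ 2 * (8 * X) := by positivity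
    nlinarith
  have hkτ : 2 * X / ε * τ ≤ 1 / 2 := by
    refine abs_le_of_sq_le_sq' ?_ (by norm_num) |>.2
    have e1 : τ ^ 2 * (16 * X ^ 2) ≤ ε ^ 2 := by
      calc τ ^ 2 * (16 * X ^ 2) = 1 * τ ^ 2 * (8 * X * (2 * X)) := by ring
        _ ≤ r * τ ^ 2 * (8 * X * l ^ 2) := by gcongr
        _ = ε ^ 2 := hrτ
    have e2 : (2 * X / ε * τ) ^ 2 = τ ^ 2 * (16 * X ^ 2) / ε ^ 2 / 4 := by
      field_simp
      ring
    rw [e2]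
    have : τ ^ 2 * (16 * X ^ 2) / ε ^ 2 ≤ 1 := (div_le_one (by positivity)).2 e1
    linarith
  -- With `k = 2 * X / ε`, the right side `k * ε + log δ` equals `X + ln 2`. The left side is at
  -- most `ε / 8 + X / 2`, which is at most `3 * X / 4` because `ε ≤ 2 * X`.
  refine isotropicGaussian_le_exp_mul_add (k := 2 * X / ε) (τ := τ) ?_ ?_ (by positivity) hδ hτ.le
    hkτ (hvv.trans (hone hv)) (hvv.trans (hone hv')) ?_ hA
  · exact (show (0 : ℝ) < v by linarith)
  · exact (show (0 : ℝ) < v' by linarith)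
  have hP : r * τ ^ 2 * X ≤ ε ^ 2 / 8 := by linarith
  have e1 : r * (2 * X / ε + 2 * (2 * X / ε) ^ 2) * τ ^ 2 / 2 =
      (1 / ε + 4 * X / ε ^ 2) * (r * τ ^ 2 * X) := by
    field_simp
    ring
  have e2 : (1 / ε + 4 * X / ε ^ 2) * (ε ^ 2 / 8) = ε / 8 + X / 2 := by
    field_simp
    ring
  have e3 : 2 * X / ε * ε = 2 * X := by field_simp
  have e4 := mul_le_mul_of_nonneg_left hP (show 0 ≤ 1 / ε + 4 * X / ε ^ 2 by positivity)
  rw [e1, e3]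
  linarith

/-! ### Gaussian vectors via characteristic functions -/

theorem charFunDual_gaussianReal_zero (v : ℝ≥0) (L : StrongDual ℝ ℝ) :
    charFunDual (gaussianReal 0 v) L = Complex.exp (-((v * L 1 ^ 2 / 2 : ℝ) : ℂ)) := by
  have hL (x : ℝ) : L x = L 1 * x := by
    conv_lhs => rw [← mul_one x, ← smul_eq_mul, map_smul, smul_eq_mul, mul_comm]
  have h : charFunDual (gaussianReal 0 v) L = charFun (gaussianReal 0 v) (L 1) := by
    rw [charFunDual_apply, charFun_apply_real]
    refine integral_congr_ae (.of_forall fun x => ?_)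
    simp only
    rw [hL x, Complex.ofReal_mul]
  rw [h, charFun_gaussianReal]
  push_cast
  congr 1
  ring

/-- A linear form on `ℝⁿ` is the dot product with its values on the standard basis. -/
theorem strongDual_apply_eq_dotProduct {n : ℕ} (L : StrongDual ℝ (Fin n → ℝ)) (x : Fin n → ℝ) :
    L x = x ⬝ᵥ fun j => L (Pi.single j 1) := by
  conv_lhs => rw [← L.sum_comp_single]
  refine Finset.sum_congr rfl fun j _ => ?_
  rw [ContinuousLinearMap.comp_apply, ContinuousLinearMap.single_apply, ← smul_eq_mul,
    ← map_smul, ← Pi.single_smul, smul_eq_mul, mul_one]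

/-- The matrix enters only through the quadratic form `t ↦ |A t|²`, so equality of quadratic forms
yields equality of laws. -/
theorem charFunDual_map_vecMul {n : ℕ} {κ : Type} [Fintype κ] [DecidableEq κ]
    (A : Matrix κ (Fin n) ℝ) (L : StrongDual ℝ (Fin n → ℝ)) :
    charFunDual ((Measure.pi fun _ : κ => gaussianReal 0 1).map fun g => Matrix.vecMul g A) L =
      Complex.exp (-((∑ k, A.mulVec (fun j => L (Pi.single j 1)) k ^ 2 / 2 : ℝ) : ℂ)) := by
  have := charFunDual_map (μ := Measure.pi fun _ : κ => gaussianReal 0 1)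
    (LinearMap.toContinuousLinearMap (Matrix.vecMulLinear A)) L
  simp only [LinearMap.coe_toContinuousLinearMap', Matrix.coe_vecMulLinear] at this
  rw [this, charFunDual_pi]
  simp_rw [charFunDual_gaussianReal_zero]
  rw [← Complex.exp_sum, Finset.sum_neg_distrib, Complex.ofReal_sum]
  congr 2
  refine Finset.sum_congr rfl fun k _ => ?_
  congr 2
  simp only [ContinuousLinearMap.comp_apply, ContinuousLinearMap.single_apply,
    LinearMap.coe_toContinuousLinearMap', Matrix.vecMulLinear_apply, Matrix.single_one_vecMul]
  rw [strongDual_apply_eq_dotProduct]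
  simp [Matrix.mulVec, Matrix.row]

theorem charFunDual_map_smul_add_vecMul {n : ℕ} {κ : Type} [Fintype κ] [DecidableEq κ] (v : ℝ≥0)
    (u : Fin n → ℝ) (P : Matrix κ (Fin n) ℝ) (L : StrongDual ℝ (Fin n → ℝ)) :
    charFunDual (((gaussianReal 0 v).prod (Measure.pi fun _ : κ => gaussianReal 0 1)).map
        fun q => q.1 • u + Matrix.vecMul q.2 P) L =
      Complex.exp (-((v * (u ⬝ᵥ fun j => L (Pi.single j 1)) ^ 2 / 2 : ℝ) : ℂ)) *
      Complex.exp (-((∑ k, P.mulVec (fun j => L (Pi.single j 1)) k ^ 2 / 2 : ℝ) : ℂ)) := by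
  set f : ℝ × (κ → ℝ) →L[ℝ] (Fin n → ℝ) :=
    ((ContinuousLinearMap.fst ℝ ℝ (κ → ℝ)).smulRight u) +
      (LinearMap.toContinuousLinearMap (Matrix.vecMulLinear P)).comp
        (ContinuousLinearMap.snd ℝ ℝ (κ → ℝ)) with hf
  have hfun : (fun q : ℝ × (κ → ℝ) => q.1 • u + Matrix.vecMul q.2 P) = f := rfl
  have hvec := charFunDual_map (μ := Measure.pi fun _ : κ => gaussianReal 0 1)
    (LinearMap.toContinuousLinearMap (Matrix.vecMulLinear P)) L
  simp only [LinearMap.coe_toContinuousLinearMap', Matrix.coe_vecMulLinear] at hvec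
  have hinr : (L.comp f).comp (ContinuousLinearMap.inr ℝ ℝ (κ → ℝ)) =
      L.comp (LinearMap.toContinuousLinearMap (Matrix.vecMulLinear P)) := by
    ext1 x
    simp [hf]
  rw [hfun, charFunDual_map, charFunDual_prod, hinr, ← hvec, charFunDual_map_vecMul,
    charFunDual_gaussianReal_zero, ← strongDual_apply_eq_dotProduct]
  simp [hf]

/-- A centered Gaussian vector splits along any decomposition of its covariance. -/
theorem map_vecMul_eq_map_smul_add_vecMul {n : ℕ} {κ κ' : Type} [Fintype κ] [Fintype κ'] {v : ℝ≥0}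
    {A : Matrix κ (Fin n) ℝ} {u : Fin n → ℝ} {P : Matrix κ' (Fin n) ℝ}
    (h : ∀ t, ∑ k, A.mulVec t k ^ 2 = v * (u ⬝ᵥ t) ^ 2 + ∑ k, P.mulVec t k ^ 2) :
    ((Measure.pi fun _ : κ => gaussianReal 0 1).map fun g => Matrix.vecMul g A) =
      ((gaussianReal 0 v).prod (Measure.pi fun _ : κ' => gaussianReal 0 1)).map
        fun q => q.1 • u + Matrix.vecMul q.2 P := by
  classical
  have hm1 : Measurable fun g : κ → ℝ => Matrix.vecMul g A :=
    (LinearMap.toContinuousLinearMap (Matrix.vecMulLinear A)).continuous.measurable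
  have hm2 : Measurable fun q : ℝ × (κ' → ℝ) => q.1 • u + Matrix.vecMul q.2 P := by
    have := (LinearMap.toContinuousLinearMap (Matrix.vecMulLinear P)).continuous.measurable
    exact (measurable_fst.smul_const u).add (this.comp measurable_snd)
  have := Measure.isProbabilityMeasure_map (μ := Measure.pi fun _ : κ => gaussianReal 0 1)
    hm1.aemeasurable
  have := Measure.isProbabilityMeasure_map
    (μ := (gaussianReal 0 v).prod (Measure.pi fun _ : κ' => gaussianReal 0 1)) hm2.aemeasurable
  refine Measure.ext_of_charFunDual ?_
  ext1 L
  rw [charFunDual_map_vecMul, charFunDual_map_smul_add_vecMul, ← Complex.exp_add, ← neg_add,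
    ← Complex.ofReal_add, ← Finset.sum_div, ← Finset.sum_div, h, add_div]

/-! ### The law of the output as postprocessed Gaussians -/

/-- The matrix `(1 / r) Yᵀ Y` of a matrix `Y` given by its `r` rows. -/
noncomputable def scaledGram {n r : ℕ} (Y : Fin r → Fin n → ℝ) : Matrix (Fin n) (Fin n) ℝ :=
  (1 / (r : ℝ)) • ((Matrix.of Y).transpose * Matrix.of Y)

theorem measurable_scaledGram {n r : ℕ} : Measurable (scaledGram (n := n) (r := r)) := by
  refine measurable_pi_lambda _ fun i => measurable_pi_lambda _ fun j => ?_
  simp only [scaledGram, Matrix.smul_apply, Matrix.mul_apply, Matrix.transpose_apply,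
    Matrix.of_apply, smul_eq_mul]
  fun_prop

theorem projectedLaplacian_eq_scaledGram {n r : ℕ} (E : Matrix (VertexPair n) (Fin n) ℝ)
    (M : Matrix (Fin r) (VertexPair n) ℝ) :
    projectedLaplacian E M = scaledGram fun i => Matrix.vecMul (M i) E := by
  have : Matrix.of (fun i => Matrix.vecMul (M i) E) = M * E := rfl
  rw [projectedLaplacian, scaledGram, this, Matrix.transpose_mul, Matrix.mul_assoc, Matrix.mul_assoc]

theorem measurable_smul_add_vecMul {n : ℕ} (r : ℕ) {κ : Type} [Fintype κ] (u : Fin n → ℝ)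
    (P : Matrix κ (Fin n) ℝ) : Measurable fun (q : (Fin r → ℝ) × (Fin r → κ → ℝ)) i =>
      q.1 i • u + Matrix.vecMul (q.2 i) P := by
  have := (LinearMap.toContinuousLinearMap (Matrix.vecMulLinear P)).continuous.measurable
  exact measurable_pi_lambda _ fun i =>
    (((measurable_pi_apply i).comp measurable_fst).smul_const u).add
      (this.comp ((measurable_pi_apply i).comp measurable_snd))

/-- The law of the published matrix, for a covariance that splits off a rank-one part. -/
theorem map_projectedLaplacian_eq {n : ℕ} (r : ℕ) {κ : Type} [Fintype κ] {v : ℝ≥0}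
    {E : Matrix (VertexPair n) (Fin n) ℝ} {u : Fin n → ℝ} {P : Matrix κ (Fin n) ℝ}
    (h : ∀ t, ∑ k, E.mulVec t k ^ 2 = v * (u ⬝ᵥ t) ^ 2 + ∑ k, P.mulVec t k ^ 2) :
    (gaussianMatrix (Fin r) (VertexPair n)).map (projectedLaplacian E) =
      ((isotropicGaussian r v).prod
        (Measure.pi fun _ : Fin r => Measure.pi fun _ : κ => gaussianReal 0 1)).map
          fun q => scaledGram fun i => q.1 i • u + Matrix.vecMul (q.2 i) P := by
  have hm1 : Measurable fun g : VertexPair n → ℝ => Matrix.vecMul g E :=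
    (LinearMap.toContinuousLinearMap (Matrix.vecMulLinear E)).continuous.measurable
  have hm2 : Measurable fun q : ℝ × (κ → ℝ) => q.1 • u + Matrix.vecMul q.2 P := by
    have := (LinearMap.toContinuousLinearMap (Matrix.vecMulLinear P)).continuous.measurable
    exact (measurable_fst.smul_const u).add (this.comp measurable_snd)
  have hrow : ((Measure.pi fun _ : Fin r => Measure.pi fun _ : VertexPair n => gaussianReal 0 1).map
      fun M i => Matrix.vecMul (M i) E) =
      ((isotropicGaussian r v).prod
        (Measure.pi fun _ : Fin r => Measure.pi fun _ : κ => gaussianReal 0 1)).map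
          fun q i => q.1 i • u + Matrix.vecMul (q.2 i) P := by
    -- Regroups `r` independent pairs (scalar, noise) into a pair of independent `r`-tuples.
    have hp := measurePreserving_arrowProdEquivProdArrow ℝ (κ → ℝ) (Fin r)
      (fun _ => gaussianReal 0 v) (fun _ => Measure.pi fun _ : κ => gaussianReal 0 1)
    have := Measure.isProbabilityMeasure_map
      (μ := Measure.pi fun _ : VertexPair n => gaussianReal 0 1) hm1.aemeasurable
    have := Measure.isProbabilityMeasure_map
      (μ := (gaussianReal 0 v).prod (Measure.pi fun _ : κ => gaussianReal 0 1)) hm2.aemeasurable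
    rw [Measure.pi_map_pi fun _ => hm1.aemeasurable, map_vecMul_eq_map_smul_add_vecMul h,
      ← Measure.pi_map_pi fun _ => hm2.aemeasurable, isotropicGaussian, ← hp.map_eq,
      Measure.map_map _ hp.measurable]
    · rfl
    · exact measurable_smul_add_vecMul r u P
  have hM1 : Measurable fun (M : Fin r → VertexPair n → ℝ) i => Matrix.vecMul (M i) E :=
    measurable_pi_lambda _ fun i => hm1.comp (measurable_pi_apply i)
  have hcomp : projectedLaplacian (r := r) E =
      fun M => scaledGram fun i => Matrix.vecMul (M i) E :=
    funext (projectedLaplacian_eq_scaledGram E)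
  rw [hcomp]
  refine ((Measure.map_map measurable_scaledGram hM1).symm.trans ?_)
  refine (congrArg (Measure.map scaledGram) hrow).trans ?_
  exact Measure.map_map measurable_scaledGram (measurable_smul_add_vecMul r u P)

/-- Approximate indistinguishability survives adding independent randomness and postprocessing. -/
theorem map_prod_le_mul_add {X Y Z : Type*} [MeasurableSpace X] [MeasurableSpace Y]
    [MeasurableSpace Z] {μ μ' : Measure X} [SFinite μ] [SFinite μ'] {ρ : Measure Y}
    [IsProbabilityMeasure ρ] {c d : ℝ≥0∞}
    (h : ∀ A, MeasurableSet A → μ A ≤ c * μ' A + d) {f : X × Y → Z} (hf : Measurable f) {S : Set Z}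
    (hS : MeasurableSet S) :
    (μ.prod ρ).map f S ≤ c * (μ'.prod ρ).map f S + d := by
  have hfS := hf hS
  -- Condition on the noise `y`: the hypothesis applies to each section, and the bound is integrated
  -- over `ρ`.
  rw [Measure.map_apply hf hS, Measure.map_apply hf hS, Measure.prod_apply_symm hfS,
    Measure.prod_apply_symm hfS]
  have hmeas := measurable_measure_prodMk_right (μ := μ') hfS
  calc _ ≤ ∫⁻ y, (c * μ' ((fun x => (x, y)) ⁻¹' (f ⁻¹' S)) + d) ∂ρ :=
        lintegral_mono fun y => h _ (measurable_prodMk_right hfS)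
    _ = _ := by
        rw [lintegral_add_right _ measurable_const, lintegral_const_mul _ hmeas, lintegral_const,
          measure_univ, mul_one]

/-! ### Laplacian quadratic forms and the complete graph -/

theorem edgeMatrix_mulVec {n : ℕ} (c : Fin n → Fin n → ℝ) (t : Fin n → ℝ) (p : VertexPair n) :
    (edgeMatrix c).mulVec t p = √(c p.1.1 p.1.2) * (t p.1.1 - t p.1.2) := by
  have hne : p.1.2 ≠ p.1.1 := p.2.ne'
  have hrow (x : Fin n) : edgeMatrix c p x = √(c p.1.1 p.1.2) *
      ((if x = p.1.1 then 1 else 0) - if x = p.1.2 then 1 else 0) := by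
    unfold edgeMatrix
    by_cases h1 : x = p.1.1
    · simp [h1, hne.symm]
    · by_cases h2 : x = p.1.2 <;> simp [h1, h2, hne]
  simp_rw [Matrix.mulVec, dotProduct, hrow, mul_assoc]
  rw [← Finset.mul_sum]
  simp [sub_mul, Finset.sum_sub_distrib]

theorem sum_edgeMatrix_mulVec_sq {n : ℕ} {c : Fin n → Fin n → ℝ}
    (hc : ∀ p : VertexPair n, 0 ≤ c p.1.1 p.1.2) (t : Fin n → ℝ) :
    ∑ p, (edgeMatrix c).mulVec t p ^ 2 =
      ∑ p : VertexPair n, c p.1.1 p.1.2 * (t p.1.1 - t p.1.2) ^ 2 :=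
  Finset.sum_congr rfl fun p _ => by rw [edgeMatrix_mulVec, mul_pow, Real.sq_sqrt (hc p)]

theorem two_mul_sum_vertexPair {n : ℕ} (t : Fin n → ℝ) :
    2 * ∑ p : VertexPair n, (t p.1.1 - t p.1.2) ^ 2 = ∑ x, ∑ y, (t x - t y) ^ 2 := by
  have h1 : ∑ p : VertexPair n, (t p.1.1 - t p.1.2) ^ 2 =
      ∑ x, ∑ y, if x < y then (t x - t y) ^ 2 else 0 := by
    rw [← Fintype.sum_prod_type', ← Finset.sum_filter]
    exact (Finset.sum_subtype (p := fun p : Fin n × Fin n => p.1 < p.2) _ (by simp)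
      fun p => (t p.1 - t p.2) ^ 2).symm
  have h2 : ∑ x, ∑ y, (if x < y then (t x - t y) ^ 2 else 0) =
      ∑ x, ∑ y, if y < x then (t x - t y) ^ 2 else 0 := by
    rw [Finset.sum_comm]
    simp_rw [fun x y => sub_sq_comm (t y) (t x)]
  have h3 (x y : Fin n) : (t x - t y) ^ 2 =
      (if x < y then (t x - t y) ^ 2 else 0) + if y < x then (t x - t y) ^ 2 else 0 := by
    rcases lt_trichotomy x y with h | h | h
    · simp [h, h.not_gt]
    · simp [h]
    · simp [h, h.not_gt]
  calc _ = ∑ x, ∑ y, (if x < y then (t x - t y) ^ 2 else 0) +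
        ∑ x, ∑ y, if y < x then (t x - t y) ^ 2 else 0 := by rw [h1, two_mul, ← h2]
    _ = ∑ x, ∑ y, (t x - t y) ^ 2 := by
      simp_rw [← Finset.sum_add_distrib]
      exact Finset.sum_congr rfl fun x _ => Finset.sum_congr rfl fun y _ => (h3 x y).symm

/-- The spectral gap of the complete graph. -/
theorem card_mul_sub_sq_le_sum {n : ℕ} {a b : Fin n} (hab : a ≠ b) (t : Fin n → ℝ) :
    n * (t a - t b) ^ 2 ≤ ∑ x, ∑ y, (t x - t y) ^ 2 := by
  have hn : (0 : ℝ) < n := by exact_mod_cast a.pos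
  set m : ℝ := (∑ x, t x) / n with hm
  have hsum : ∑ x, (t x - m) = 0 := by
    rw [Finset.sum_sub_distrib, Finset.sum_const, Finset.card_univ, Fintype.card_fin, nsmul_eq_mul,
      hm]
    field_simp
    ring
  -- Centering at the mean kills the cross terms.
  have hexp : ∑ x, ∑ y, (t x - t y) ^ 2 = 2 * n * ∑ x, (t x - m) ^ 2 := by
    have hpt (x y : Fin n) : (t x - t y) ^ 2 =
        (t x - m) ^ 2 + (t y - m) ^ 2 - 2 * (t x - m) * (t y - m) := by ring
    simp_rw [hpt, Finset.sum_sub_distrib, Finset.sum_add_distrib, ← Finset.mul_sum, hsum]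
    simp [← Finset.mul_sum]
    ring
  have hpair : (t a - m) ^ 2 + (t b - m) ^ 2 ≤ ∑ x, (t x - m) ^ 2 := by
    rw [← Finset.sum_pair (f := fun x => (t x - m) ^ 2) hab]
    exact Finset.sum_le_sum_of_subset_of_nonneg (Finset.subset_univ _) fun _ _ _ => sq_nonneg _
  have h2 : (t a - t b) ^ 2 ≤ 2 * ((t a - m) ^ 2 + (t b - m) ^ 2) := by
    nlinarith [sq_nonneg (t a - m + (t b - m))]
  rw [hexp]
  calc n * (t a - t b) ^ 2 ≤ n * (2 * ∑ x, (t x - m) ^ 2) := by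
        gcongr
        linarith
    _ = _ := by ring

/-- Splitting the edge `p₀` off the quadratic form of a graph all of whose weights are at least
`w / n`. The remainder does not depend on the weight of `p₀`. -/
theorem exists_rank_one_splitting {n : ℕ} (p₀ : VertexPair n) {w : ℝ} (hw : 0 ≤ w)
    (c : VertexPair n → ℝ) (hc : ∀ p, w / n ≤ c p) :
    ∃ (m : ℕ) (P : Matrix (Fin m) (Fin n) ℝ), ∀ t : Fin n → ℝ,
      ∑ k, P.mulVec t k ^ 2 = ∑ p, (if p = p₀ then w / n else c p) * (t p.1.1 - t p.1.2) ^ 2 -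
        w / 2 * (t p₀.1.1 - t p₀.1.2) ^ 2 := by
  have hn : (0 : ℝ) < n := by exact_mod_cast p₀.1.1.pos
  set B : VertexPair n → Fin n → ℝ := fun p => Pi.single p.1.1 1 - Pi.single p.1.2 1 with hB
  have hBt (p : VertexPair n) (t : Fin n → ℝ) : B p ⬝ᵥ t = t p.1.1 - t p.1.2 := by
    simp [hB, sub_dotProduct]
  set Q : Matrix (Fin n) (Fin n) ℝ :=
    ∑ p, (if p = p₀ then w / n else c p) • Matrix.vecMulVec (B p) (B p) -
      (w / 2) • Matrix.vecMulVec (B p₀) (B p₀) with hQ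
  have hrank (x t : Fin n → ℝ) : t ⬝ᵥ (Matrix.vecMulVec x x).mulVec t = (x ⬝ᵥ t) ^ 2 := by
    simp [Matrix.vecMulVec_mulVec, dotProduct_smul, dotProduct_comm t x, sq]
  have hQt (t : Fin n → ℝ) : t ⬝ᵥ Q.mulVec t =
      ∑ p, (if p = p₀ then w / n else c p) * (t p.1.1 - t p.1.2) ^ 2 -
        w / 2 * (t p₀.1.1 - t p₀.1.2) ^ 2 := by
    rw [hQ, Matrix.sub_mulVec, Matrix.sum_mulVec, dotProduct_sub, dotProduct_sum]
    simp_rw [Matrix.smul_mulVec, dotProduct_smul, hrank, hBt, smul_eq_mul]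
  -- Every coefficient is at least `w / n`, so the form dominates that of the weighted complete
  -- graph, whose gap pays for the subtracted `w / 2` term.
  have hpos : Q.PosSemidef := by
    refine .of_dotProduct_mulVec_nonneg ?_ fun t => ?_
    · refine Matrix.ext fun i j => ?_
      simp only [hQ, Matrix.conjTranspose_apply, Matrix.sub_apply, Matrix.sum_apply,
        Matrix.smul_apply, Matrix.vecMulVec_apply, star_trivial]
      simp_rw [fun p => mul_comm (B p j) (B p i)]
    · rw [star_trivial, hQt, sub_nonneg]
      have hgap := card_mul_sub_sq_le_sum p₀.2.ne t
      rw [← two_mul_sum_vertexPair] at hgap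
      calc w / 2 * (t p₀.1.1 - t p₀.1.2) ^ 2
          = w / (2 * n) * (n * (t p₀.1.1 - t p₀.1.2) ^ 2) := by field_simp
        _ ≤ w / (2 * n) * (2 * ∑ p : VertexPair n, (t p.1.1 - t p.1.2) ^ 2) := by gcongr
        _ = ∑ p : VertexPair n, w / n * (t p.1.1 - t p.1.2) ^ 2 := by
          rw [← Finset.mul_sum]
          field_simp
        _ ≤ _ := by
          refine Finset.sum_le_sum fun p _ => ?_
          gcongr
          split_ifs
          · exact le_rfl
          · exact hc p
  -- The vectors of a rank-one decomposition of `Q` serve as the rows of `P`.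
  obtain ⟨m, y, hy⟩ := Matrix.posSemidef_iff_eq_sum_vecMulVec.1 hpos
  refine ⟨m, Matrix.of y, fun t => ?_⟩
  rw [← hQt, hy, Matrix.sum_mulVec, dotProduct_sum]
  exact Finset.sum_congr rfl fun k _ => (hrank (y k) t).symm

theorem div_le_mixedWeight {n : ℕ} (G : WeightedGraph n) {w : ℝ} (hwn : w ≤ n) (p : VertexPair n) :
    w / n ≤ G.mixedWeight w p.1.1 p.1.2 := by
  have h1 : w / n ≤ 1 := div_le_one_of_le₀ hwn n.cast_nonneg
  rw [WeightedGraph.mixedWeight, if_neg p.2.ne]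
  nlinarith [G.nonneg p.1.1 p.1.2]

/-- Neighboring graphs publish the same function of a common noise and of isotropic Gaussians whose
variances are at least `w / 2` and differ by at most `1`. -/
theorem exists_common_splitting {n : ℕ} {G G' : WeightedGraph n} (hG : G.Neighbor G') {w : ℝ}
    (hw : 0 ≤ w) (hwn : w ≤ n) :
    ∃ (m : ℕ) (P : Matrix (Fin m) (Fin n) ℝ) (u : Fin n → ℝ) (v v' : ℝ≥0),
      w / 2 ≤ v ∧ w / 2 ≤ v' ∧ |(v : ℝ) - v'| ≤ 1 ∧
      (∀ t, ∑ k, (edgeMatrix (G.mixedWeight w)).mulVec t k ^ 2 =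
        v * (u ⬝ᵥ t) ^ 2 + ∑ k, P.mulVec t k ^ 2) ∧
      (∀ t, ∑ k, (edgeMatrix (G'.mixedWeight w)).mulVec t k ^ 2 =
        v' * (u ⬝ᵥ t) ^ 2 + ∑ k, P.mulVec t k ^ 2) := by
  obtain ⟨p₀, hp₀⟩ : ∃ p₀ : VertexPair n, ∀ p : VertexPair n, p ≠ p₀ →
      G.weight p.1.1 p.1.2 = G'.weight p.1.1 p.1.2 := by
    obtain ⟨a, b, hab, h⟩ := hG
    rcases hab.lt_or_gt with hlt | hlt
    · refine ⟨⟨(a, b), hlt⟩, fun p hp => h _ _ fun he => ?_⟩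
      rcases Sym2.eq_iff.1 he with ⟨h1, h2⟩ | ⟨h1, h2⟩
      · exact hp (Subtype.ext (Prod.ext h1 h2))
      · exact absurd (h1 ▸ h2 ▸ p.2 : b < a) hlt.asymm
    · refine ⟨⟨(b, a), hlt⟩, fun p hp => h _ _ fun he => ?_⟩
      rcases Sym2.eq_iff.1 he with ⟨h1, h2⟩ | ⟨h1, h2⟩
      · exact absurd (h1 ▸ h2 ▸ p.2 : a < b) hlt.asymm
      · exact hp (Subtype.ext (Prod.ext h1 h2))
  have hw1 : w / n ≤ 1 := div_le_one_of_le₀ hwn n.cast_nonneg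
  have hw0 : 0 ≤ w / n := by positivity
  -- Built from `G`, but with the weight of `p₀` lowered to `w / n`; so the same `P` serves `G'`.
  obtain ⟨m, P, hP⟩ := exists_rank_one_splitting p₀ hw
    (fun p => G.mixedWeight w p.1.1 p.1.2) (div_le_mixedWeight G hwn)
  have key (H : WeightedGraph n) (hH : ∀ p : VertexPair n, p ≠ p₀ →
      G.weight p.1.1 p.1.2 = H.weight p.1.1 p.1.2) (t : Fin n → ℝ) :
      ∑ k, (edgeMatrix (H.mixedWeight w)).mulVec t k ^ 2 =
        (w / 2 + (H.mixedWeight w p₀.1.1 p₀.1.2 - w / n)) *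
          ((Pi.single p₀.1.1 1 - Pi.single p₀.1.2 1) ⬝ᵥ t) ^ 2 + ∑ k, P.mulVec t k ^ 2 := by
    rw [sum_edgeMatrix_mulVec_sq fun p => hw0.trans (div_le_mixedWeight H hwn p), hP]
    have hdot : (Pi.single p₀.1.1 1 - Pi.single p₀.1.2 1) ⬝ᵥ t = t p₀.1.1 - t p₀.1.2 := by
      simp [sub_dotProduct]
    rw [hdot, ← Finset.add_sum_erase _ _ (Finset.mem_univ p₀),
      ← Finset.add_sum_erase (f := fun p : VertexPair n =>
        (if p = p₀ then w / n else G.mixedWeight w p.1.1 p.1.2) * (t p.1.1 - t p.1.2) ^ 2) _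
        (Finset.mem_univ p₀)]
    have hrest : ∑ p ∈ Finset.univ.erase p₀,
        (if p = p₀ then w / n else G.mixedWeight w p.1.1 p.1.2) * (t p.1.1 - t p.1.2) ^ 2 =
        ∑ p ∈ Finset.univ.erase p₀, H.mixedWeight w p.1.1 p.1.2 * (t p.1.1 - t p.1.2) ^ 2 := by
      refine Finset.sum_congr rfl fun p hp => ?_
      have hne := Finset.ne_of_mem_erase hp
      rw [if_neg hne, WeightedGraph.mixedWeight, WeightedGraph.mixedWeight, hH p hne]
    rw [hrest, if_pos rfl]
    ring
  have hge (H : WeightedGraph n) : w / 2 ≤ w / 2 + (H.mixedWeight w p₀.1.1 p₀.1.2 - w / n) := by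
    linarith [div_le_mixedWeight H hwn p₀]
  refine ⟨m, P, Pi.single p₀.1.1 1 - Pi.single p₀.1.2 1,
    ⟨_, (div_nonneg hw zero_le_two).trans (hge G)⟩, ⟨_, (div_nonneg hw zero_le_two).trans (hge G')⟩,
    hge G, hge G', ?_, key G fun _ _ => rfl, key G' hp₀⟩
  -- Mixing scales the weight change by `1 - w / n`, which lies in `[0, 1]` because `0 ≤ w ≤ n`.
  have hdiff : w / 2 + (G.mixedWeight w p₀.1.1 p₀.1.2 - w / n) -
      (w / 2 + (G'.mixedWeight w p₀.1.1 p₀.1.2 - w / n)) =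
      (1 - w / n) * (G.weight p₀.1.1 p₀.1.2 - G'.weight p₀.1.1 p₀.1.2) := by
    rw [WeightedGraph.mixedWeight, WeightedGraph.mixedWeight, if_neg p₀.2.ne, if_neg p₀.2.ne]
    ring
  have h1 : |G.weight p₀.1.1 p₀.1.2 - G'.weight p₀.1.1 p₀.1.2| ≤ 1 :=
    abs_le.2 ⟨by linarith [G.nonneg p₀.1.1 p₀.1.2, G'.le_one p₀.1.1 p₀.1.2],
      by linarith [G'.nonneg p₀.1.1 p₀.1.2, G.le_one p₀.1.1 p₀.1.2]⟩
  change |w / 2 + (G.mixedWeight w p₀.1.1 p₀.1.2 - w / n) -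
      (w / 2 + (G'.mixedWeight w p₀.1.1 p₀.1.2 - w / n))| ≤ 1
  rw [hdiff, abs_mul, abs_of_nonneg (by linarith)]
  exact mul_le_one₀ (by linarith) (abs_nonneg _) h1

theorem mainTheorem1 (n : ℕ) (ε δ η ν : ℝ) (hε : 0 < ε) (hδ : 0 < δ) (hη : 0 < η)
    (hν : 0 < ν) (hν2 : ν < 2) (hεδ : ε ≤ 2 * Real.log (2 / δ))
    (hw : mixWeight ε δ (numRows η ν) ≤ n) :
    IsDifferentiallyPrivate (WeightedGraph.Neighbor (n := n))
      (publishLaplacian ε δ η ν) ε δ := by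
  intro G G' hG S hS
  -- For `δ ≥ 1` the claim is trivial; `δ < 1` makes `ln (2 / δ) ≥ ln 2`, on which the estimates
  -- rest.
  rcases le_or_gt 1 δ with hδ1 | hδ1
  · calc (publishLaplacian ε δ η ν G).real S ≤ 1 := measureReal_le_one
      _ ≤ δ := hδ1
      _ ≤ _ := le_add_of_nonneg_left (by positivity)
  have hr := one_le_numRows hη hν hν2
  have hwpos := mixWeight_pos hε hδ hδ1 hr
  obtain ⟨m, P, u, v, v', hv, hv', hvv, h, h'⟩ := exists_common_splitting hG hwpos.le hw
  have hf : Measurable fun q : (Fin (numRows η ν) → ℝ) × (Fin (numRows η ν) → Fin m → ℝ) =>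
      scaledGram fun i => q.1 i • u + Matrix.vecMul (q.2 i) P :=
    measurable_scaledGram.comp (measurable_smul_add_vecMul _ u P)
  have hle : publishLaplacian ε δ η ν G S ≤
      ENNReal.ofReal (Real.exp ε) * publishLaplacian ε δ η ν G' S + ENNReal.ofReal δ := by
    rw [publishLaplacian, publishLaplacian, map_projectedLaplacian_eq _ h,
      map_projectedLaplacian_eq _ h']
    exact map_prod_le_mul_add
      (fun A hA => isotropicGaussian_le_of_mixWeight hε hδ hδ1 hεδ hr hv' hv hvv hA) hf hS
  have hfin : ENNReal.ofReal (Real.exp ε) * publishLaplacian ε δ η ν G' S ≠ ∞ :=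
    ENNReal.mul_ne_top ENNReal.ofReal_ne_top (measure_ne_top _ _)
  have := ENNReal.toReal_mono (ENNReal.add_ne_top.2 ⟨hfin, ENNReal.ofReal_ne_top⟩) hle
  rwa [ENNReal.toReal_add hfin ENNReal.ofReal_ne_top, ENNReal.toReal_mul,
    ENNReal.toReal_ofReal (Real.exp_pos ε).le, ENNReal.toReal_ofReal hδ.le] at this
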